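/- Let $n\ge 2$ be an integer. Particles $j=1,2,3,\dots$ are placed on $\mathbb Z$ one after another; $w(j,t)$ denotes the position of particle $j$ at time $t=1,2,\dots$. Put $w(1,t)=0$ for all $t$. Suppose $j\ge 2$ and the trajectories of particles $1,\dots,j-1$ have been constructed. For $k\in\mathbb Z$ and $i\le j-1$ let $$f(k,i)=\bigl|\{\,1\le i'\le i:\ \lim_{t\to\infty}w(i',t)=k\,\}\bigr|$$ be the number of particles among the first $i$ that freeze at $k$. Particle $j$ starts with $w(j,1)=j+2$ and $w(j,2)=j+1$. For $t\ge 2$: if $w(j,t)=w(j,t-1)$, then $w(j,t+1)=w(j,t)$. Otherwise, conditionally on the trajectories of particles $1,\dots,j-1$ and on $w(j,1),\dots,w(j,t)$, with $m=f(w(j,t)-1,\,j-1)$, $$w(j,t+1)=\begin{cases} w(j,t) & \text{with probability } \frac{m}{n},\\ w(j,t)+1 & \text{with probability } \frac{n-m}{2n},\\ w(j,t)-1 & \text{with probability } \frac{n-m}{2n}.\end{cases}$$ Almost surely every particle freezes (its position converges) and $f\le n$. There is a blockage at $k\in\mathbb Z$ if $f(k,i)=n$ for some $i$; let $B=\inf\{k\in\mathbb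 Z:\text{ there is a blockage at }k\}$ be the position of the leftmost blockage, with $B=+\infty$ if there is none. Then there is a constant $c>0$, not depending on $n$, such that for every integer $n\ge 2$, $$\mathbf P\bigl(B<e^{cn}\bigr)<e^{-cn}.$$ -/

import Mathlib

open MeasureTheory ProbabilityTheory Filter Topology

noncomputable section

namespace Clogging

/-- One move of a particle that was at `prev` and is now at `cur`, when `g k` earlier particles
are frozen at site `k` and `u` is a uniform sample from `[0,1]`.
If `cur = prev` the particle is already frozen and stays. Otherwise, with `m = g (cur - 1)`, it
stays (freezes) with probability `m / n`, and moves to `cur + 1`, to `cur - 1`, with probability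
`(n - m) / (2 n)` each. -/
def step (n : ℕ) (g : ℤ → ℕ) (prev cur : ℤ) (u : ℝ) : ℤ :=
  if cur = prev then cur
  else if u < (g (cur - 1) : ℝ) / n then cur
  else if u < (g (cur - 1) : ℝ) / n + ((n : ℝ) - g (cur - 1)) / (2 * n) then cur + 1
  else cur - 1

/-- The trajectory of particle `j ≥ 2`, given the numbers `g k` of earlier particles frozen at `k`
and the samples `u t` driving its moves. Times are counted from `0`: the particle is at `j + 2`
at time `0`, at `j + 1` at time `1`, and moves by `step` from then on. -/
def path (n : ℕ) (g : ℤ → ℕ) (j : ℕ) (u : ℕ → ℝ) : ℕ → ℤ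
  | 0 => (j : ℤ) + 2
  | 1 => (j : ℤ) + 1
  | t + 2 => step n g (path n g j u t) (path n g j u (t + 1)) (u t)

open Classical in
/-- `frozen n u i k` is the number of particles with label in `{1, …, i}` that freeze at site `k`,
that is, whose trajectory converges to `k` (see `frozen_eq_card`).
Particle `1` sits at `0` forever; the trajectory of particle `i + 2` is driven by the samples
`u (i + 2)` and by the numbers of particles among `1, …, i + 1` frozen at the various sites. -/
def frozen (n : ℕ) (u : ℕ → ℕ → ℝ) : ℕ → ℤ → ℕ
  | 0, _ => 0
  | 1, k => if k = 0 then 1 else 0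
  | i + 2, k => frozen n u (i + 1) k +
      if Tendsto (path n (frozen n u (i + 1)) (i + 2) (u (i + 2))) atTop (𝓝 k) then 1 else 0

/-- `position n u j t`: the location of particle `j ≥ 1` at time `t`. -/
def position (n : ℕ) (u : ℕ → ℕ → ℝ) (j : ℕ) : ℕ → ℤ :=
  if j ≤ 1 then fun _ => 0 else path n (frozen n u (j - 1)) j (u j)

/-- Particle `j` freezes at `k`: its position converges to `k` (in the discrete space `ℤ`). -/
def FreezesAt (n : ℕ) (u : ℕ → ℕ → ℝ) (j : ℕ) (k : ℤ) : Prop :=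
  Tendsto (position n u j) atTop (𝓝 k)

open Classical in
theorem frozen_eq_card (n : ℕ) (u : ℕ → ℕ → ℝ) (i : ℕ) (k : ℤ) :
    frozen n u i k = ((Finset.Icc 1 i).filter fun j => FreezesAt n u j k).card := by
  induction i with
  | zero => simp [frozen]
  | succ i ih =>
    rw [← Finset.insert_Icc_right_eq_Icc_add_one (by omega), Finset.filter_insert]
    cases i with
    | zero =>
      have h : FreezesAt n u (0 + 1) k ↔ k = 0 := by
        rw [FreezesAt, position, if_pos (by omega), tendsto_const_nhds_iff, eq_comm]
      by_cases hk : k = 0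
      · rw [if_pos (h.2 hk), zero_add, frozen, if_pos hk]; rfl
      · rw [if_neg (fun h' => hk (h.1 h')), zero_add, frozen, if_neg hk]; rfl
    | succ i =>
      have h : FreezesAt n u (i + 1 + 1) k ↔
          Tendsto (path n (frozen n u (i + 1)) (i + 2) (u (i + 2))) atTop (𝓝 k) := by
        simp [FreezesAt, position]
      by_cases hk : FreezesAt n u (i + 1 + 1) k
      · rw [if_pos hk, Finset.card_insert_of_notMem (by simp), ← ih, frozen, if_pos (h.1 hk)]
      · rw [if_neg hk, ← ih, frozen, if_neg (fun h' => hk (h.2 h')), add_zero]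

/-- There is a blockage at `k`: at some stage exactly `n` particles are frozen at `k`. -/
def Blockage (n : ℕ) (u : ℕ → ℕ → ℝ) (k : ℤ) : Prop :=
  ∃ i : ℕ, frozen n u i k = n

/-- The position `B` of the leftmost blockage, `+∞` if there is none. -/
def leftmostBlockage (n : ℕ) (u : ℕ → ℕ → ℝ) : EReal :=
  ⨅ (k : ℤ) (_ : Blockage n u k), ((k : ℝ) : EReal)

end Clogging

end

/-!
The proof compares neighbouring sites. Fix a site `k`, condition on the past, and let `m < n` be the
number of particles frozen at `k`. Each time the next particle is at `k + 1` after a genuine move,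
it freezes there with probability `m / n` and steps to `k` with probability `(n - m) / (2 n)`. Since
it starts to the right of `k`, it cannot freeze at `k` without such a step, so
`P(freezes at k) ≤ (n - m) / (2 m) * P(freezes at k + 1)` (`freezing_balance`). As `k` fills up, its
right neighbour therefore fills up much faster, and it is exponentially unlikely that `k` is full
before `k + 1` is.

This is quantified by a supermartingale (`potential`, `lintegral_potential_le`): a particle freezing
at `k` multiplies it by `1 + m / (2 (n - m))`, one freezing at `k + 1` by `3 / 4`. If `k` receives
`n` particles while `k + 1` has fewer than `n`, the potential reaches
`(3 / 4) ^ (n - 1) * ∏ m < n, (1 + m / (2 (n - m))) = (3 / 4) ^ (n - 1) * centralBinom n / 2 ^ n`,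
which is at least `(9 / 8) ^ (n - 1)`. By Markov's inequality this has probability at most
`(8 / 9) ^ (n - 1)` (`measure_full_before_right_le`).

A full site cannot be passed from the right, so the blockage that occurs first in time is the
leftmost one, and when it occurs its right neighbour is not full (`Blockage.exists_first`). It only
remains to sum over the sites `1 ≤ k < exp (c n)`, with `c = 1 / 50`.
-/

open scoped ENNReal

namespace Clogging

/-! ### Trajectories -/

section Path

variable {n : ℕ} {g : ℤ → ℕ} {j : ℕ} {u : ℕ → ℝ}

theorem path_add_two (t : ℕ) :
    path n g j u (t + 2) = step n g (path n g j u t) (path n g j u (t + 1)) (u t) := rfl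

theorem step_eq_cur {prev cur : ℤ} {v : ℝ} (hne : cur ≠ prev) (h : step n g prev cur v = cur) :
    v < (g (cur - 1) : ℝ) / n := by
  unfold step at h
  split_ifs at h
  · exact absurd ‹cur = prev› hne
  · assumption
  · omega
  · omega

theorem step_lt_cur {prev cur : ℤ} {v : ℝ} (h : step n g prev cur v < cur) :
    cur ≠ prev ∧ step n g prev cur v = cur - 1 ∧
      (g (cur - 1) : ℝ) / n + ((n : ℝ) - g (cur - 1)) / (2 * n) ≤ v := by
  unfold step at h ⊢
  split_ifs at h ⊢
  all_goals first | omega | skip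
  exact ⟨by assumption, rfl, by linarith⟩

theorem path_eq_of_path_succ_eq {t : ℕ} (h : path n g j u (t + 1) = path n g j u t) {s : ℕ}
    (hs : t ≤ s) : path n g j u s = path n g j u t := by
  have key : ∀ r, path n g j u (t + r) = path n g j u t ∧
      path n g j u (t + r + 1) = path n g j u t := by
    intro r
    induction r with
    | zero => exact ⟨rfl, h⟩
    | succ r ih =>
      refine ⟨ih.2, ?_⟩
      change path n g j u (t + r + 2) = _
      rw [path_add_two, step, if_pos (ih.2.trans ih.1.symm), ih.2]
  obtain ⟨r, rfl⟩ := Nat.exists_eq_add_of_le hs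
  exact (key r).1

theorem tendsto_path_of_freeze {t : ℕ} {k : ℤ} (h : path n g j u (t + 1) = k)
    (h' : u t < (g (k - 1) : ℝ) / n) : Tendsto (path n g j u) atTop (𝓝 k) := by
  have h2 : path n g j u (t + 2) = path n g j u (t + 1) := by
    rw [path_add_two, step]
    split_ifs with h3 h4
    · rfl
    · rfl
    · exact absurd (by rwa [h]) h4
    · exact absurd (by rwa [h]) h4
  refine tendsto_const_nhds.congr' ?_
  filter_upwards [eventually_ge_atTop (t + 1)] with s hs
  rw [path_eq_of_path_succ_eq h2 hs, h]

/-- A particle that converges to `k` has a freezing time: it arrives at `k` by a genuine move,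
and the next sample makes it stay. -/
theorem exists_freeze_of_tendsto {k : ℤ} (h : Tendsto (path n g j u) atTop (𝓝 k)) :
    ∃ t, path n g j u (t + 1) = k ∧ u t < (g (k - 1) : ℝ) / n := by
  classical
  rw [nhds_discrete, tendsto_pure, eventually_atTop] at h
  obtain ⟨N, hN⟩ := h
  have hex : ∃ t, path n g j u (t + 1) = path n g j u t :=
    ⟨N, (hN _ (by omega)).trans (hN _ le_rfl).symm⟩
  have hT := Nat.find_spec hex
  have hmin := fun s => Nat.find_min (m := s) hex
  generalize Nat.find hex = T at hT hmin
  have hk : path n g j u T = k := by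
    rw [← path_eq_of_path_succ_eq hT (le_max_left T N)]
    exact hN _ (le_max_right T N)
  cases T with
  | zero => simp [path] at hT
  | succ t =>
    refine ⟨t, hk, ?_⟩
    rw [path_add_two] at hT
    have := step_eq_cur (hmin t (by omega)) hT
    rwa [hk] at this

/-- A particle that freezes at `k`, to the left of its starting point, steps at some time
from `k + 1` to `k`. -/
theorem exists_stepDown_of_tendsto {k : ℤ} (hk : k ≤ j)
    (h : Tendsto (path n g j u) atTop (𝓝 k)) :
    ∃ t, path n g j u t ≠ path n g j u (t + 1) ∧ path n g j u (t + 1) = k + 1 ∧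
      (g k : ℝ) / n + ((n : ℝ) - g k) / (2 * n) ≤ u t := by
  classical
  rw [nhds_discrete, tendsto_pure, eventually_atTop] at h
  obtain ⟨N, hN⟩ := h
  have hex : ∃ t, path n g j u t ≤ k := ⟨N, (hN N le_rfl).le⟩
  have hT := Nat.find_spec hex
  have hmin := fun s => Nat.find_min (m := s) hex
  generalize Nat.find hex = T at hT hmin
  match T with
  | 0 => simp only [path] at hT; omega
  | 1 => simp only [path] at hT; omega
  | t + 2 =>
    have h1 := hmin (t + 1) (by omega)
    rw [path_add_two] at hT
    obtain ⟨hne, heq, hu⟩ := step_lt_cur (n := n) (g := g) (prev := path n g j u t)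
      (cur := path n g j u (t + 1)) (v := u t) (by omega)
    have h2 : path n g j u (t + 1) = k + 1 := by omega
    refine ⟨t, hne.symm, h2, ?_⟩
    simpa [h2] using hu

/-- A site holding `n` particles cannot be passed from the right. -/
theorem lt_path_of_full (hn : 0 < n) (hu : ∀ t, u t < 1) {k : ℤ} (hg : n ≤ g k) (hk : k ≤ j)
    (t : ℕ) : k < path n g j u t := by
  suffices h : k < path n g j u t ∧ k < path n g j u (t + 1) from h.1
  induction t with
  | zero => simp only [path]; omega
  | succ t ih =>
    refine ⟨ih.2, ?_⟩
    change k < path n g j u (t + 2)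
    rw [path_add_two]
    by_contra hcon
    obtain ⟨-, heq, hv⟩ := step_lt_cur (n := n) (g := g) (prev := path n g j u t)
      (cur := path n g j u (t + 1)) (v := u t) (by omega)
    have h2 : path n g j u (t + 1) - 1 = k := by omega
    rw [h2] at hv
    have hn' : (0 : ℝ) < n := by exact_mod_cast hn
    have hg' : (n : ℝ) ≤ g k := by exact_mod_cast hg
    have h3 : (g k : ℝ) / n + ((n : ℝ) - g k) / (2 * n) = 1 + (g k - n) / (2 * n) := by
      field_simp; ring
    have h4 : 0 ≤ ((g k : ℝ) - n) / (2 * n) := div_nonneg (by linarith) (by linarith)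
    linarith [hu t]

end Path

/-! ### Counts of frozen particles -/

section Frozen

variable {n : ℕ} {u : ℕ → ℕ → ℝ}

theorem freezesAt_add_two {i : ℕ} {k : ℤ} : FreezesAt n u (i + 2) k ↔
    Tendsto (path n (frozen n u (i + 1)) (i + 2) (u (i + 2))) atTop (𝓝 k) := by
  simp [FreezesAt, position]

theorem FreezesAt.unique {j : ℕ} {k k' : ℤ} (h : FreezesAt n u j k) (h' : FreezesAt n u j k') :
    k = k' :=
  tendsto_nhds_unique h h'

open Classical in
theorem frozen_add_two (i : ℕ) (k : ℤ) : frozen n u (i + 2) k =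
    frozen n u (i + 1) k + if FreezesAt n u (i + 2) k then 1 else 0 := by
  rw [frozen]
  congr 1

theorem frozen_add_two_of_freezesAt {i : ℕ} {k : ℤ} (h : FreezesAt n u (i + 2) k) :
    frozen n u (i + 2) k = frozen n u (i + 1) k + 1 := by
  rw [frozen_add_two, if_pos h]

theorem frozen_add_two_of_not_freezesAt {i : ℕ} {k : ℤ} (h : ¬ FreezesAt n u (i + 2) k) :
    frozen n u (i + 2) k = frozen n u (i + 1) k := by
  rw [frozen_add_two, if_neg h, add_zero]

theorem frozen_mono (k : ℤ) : Monotone fun i => frozen n u i k := by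
  refine monotone_nat_of_le_succ fun i => ?_
  match i with
  | 0 => simp [frozen]
  | i + 1 =>
    change frozen n u (i + 1) k ≤ frozen n u (i + 2) k
    rw [frozen_add_two]
    omega

theorem frozen_one_le (k : ℤ) : frozen n u 1 k ≤ 1 := by
  simp only [frozen]
  split_ifs <;> omega

theorem frozen_one_of_pos {k : ℤ} (hk : 0 < k) : frozen n u 1 k = 0 := by
  simp only [frozen]
  rw [if_neg (by omega)]

theorem frozen_sub_one_ne_zero (hu : ∀ j t, 0 ≤ u j t) {i : ℕ} {k : ℤ}
    (h : FreezesAt n u (i + 2) k) : frozen n u (i + 1) (k - 1) ≠ 0 := by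
  obtain ⟨t, -, ht⟩ := exists_freeze_of_tendsto (freezesAt_add_two.1 h)
  intro h0
  rw [h0] at ht
  simp only [Nat.cast_zero, zero_div] at ht
  exact absurd ht (not_lt.2 (hu _ _))

/-- The first `i` particles occupy only sites `0, …, i - 1`. -/
theorem mem_Ico_of_frozen_ne_zero (hu : ∀ j t, 0 ≤ u j t) {i : ℕ} {k : ℤ}
    (h : frozen n u i k ≠ 0) : 0 ≤ k ∧ k < i := by
  induction i generalizing k with
  | zero => simp [frozen] at h
  | succ i ih =>
    cases i with
    | zero =>
      have : k = 0 := by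
        by_contra hk
        simp [frozen, hk] at h
      subst this
      simp
    | succ i =>
      by_cases hf : FreezesAt n u (i + 2) k
      · have := ih (frozen_sub_one_ne_zero hu hf)
        push_cast at this ⊢
        omega
      · rw [frozen_add_two_of_not_freezesAt hf] at h
        have := ih h
        push_cast at this ⊢
        omega

theorem FreezesAt.mem_Ico (hu : ∀ j t, 0 ≤ u j t) {i : ℕ} {k : ℤ}
    (h : FreezesAt n u (i + 2) k) : 1 ≤ k ∧ k < i + 2 := by
  have := mem_Ico_of_frozen_ne_zero hu (frozen_sub_one_ne_zero hu h)
  push_cast at this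
  omega

/-- Once `k` is full, no further particle freezes at `k` or to its left. -/
theorem frozen_eq_of_full_right (hn : 0 < n) (hu : ∀ j t, 0 ≤ u j t) (hu' : ∀ j t, u j t < 1)
    {k l : ℤ} (hl : l ≤ k) {i : ℕ} (hi : n ≤ frozen n u (i + 1) k) {s : ℕ} (hs : i ≤ s) :
    frozen n u (s + 1) l = frozen n u (i + 1) l := by
  induction s, hs using Nat.le_induction with
  | base => rfl
  | succ s hs ih =>
    rw [← ih]
    refine frozen_add_two_of_not_freezesAt fun h => ?_
    have hfull : n ≤ frozen n u (s + 1) k := hi.trans (frozen_mono k (by omega))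
    have hk := (mem_Ico_of_frozen_ne_zero hu (Nat.ne_of_gt (hn.trans_le hfull))).2
    have : k + 1 ≤ l := ge_of_tendsto' (freezesAt_add_two.1 h) fun t =>
      lt_path_of_full hn (hu' (s + 2)) hfull (by push_cast at hk ⊢; omega) t
    omega

/-- The first blockage in time lies to the left of all others, and at that time the site to its
right is not yet full. -/
theorem Blockage.exists_first (hn : 2 ≤ n) (hu : ∀ j t, 0 ≤ u j t) (hu' : ∀ j t, u j t < 1)
    {k₀ : ℤ} (h : Blockage n u k₀) :
    ∃ k : ℤ, 1 ≤ k ∧ k ≤ k₀ ∧ ∃ i, frozen n u (i + 1) k = n ∧ frozen n u (i + 1) (k + 1) < n := by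
  classical
  obtain ⟨i₀, hi₀⟩ := h
  have hex : ∃ i, ∃ k, n ≤ frozen n u i k := ⟨i₀, k₀, hi₀.ge⟩
  have hT := Nat.find_spec hex
  have hle := Nat.find_min' hex ⟨k₀, hi₀.ge⟩
  have hmin := fun s => Nat.find_min (m := s) hex
  generalize Nat.find hex = T at hT hmin hle
  obtain ⟨k, hk⟩ := hT
  match T with
  | 0 => simp only [frozen] at hk; omega
  | 1 => have := frozen_one_le (n := n) (u := u) k; omega
  | i + 2 =>
    have hlt : ∀ l, frozen n u (i + 1) l < n := by
      simpa using hmin (i + 1) (by omega)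
    have hf : FreezesAt n u (i + 2) k := by
      by_contra hf
      rw [frozen_add_two_of_not_freezesAt hf] at hk
      exact absurd hk (not_le.2 (hlt k))
    have hother : ∀ l, l ≠ k → frozen n u (i + 2) l < n := fun l hl => by
      rw [frozen_add_two_of_not_freezesAt fun h => hl (h.unique hf)]
      exact hlt l
    refine ⟨k, (hf.mem_Ico hu).1, ?_, i + 1, ?_, hother _ (by omega)⟩
    · by_contra hcon
      have heq := frozen_eq_of_full_right (by omega) hu hu' (l := k₀) (k := k) (i := i + 1)
        (by omega) hk (s := i₀ - 1) (by omega)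
      rw [Nat.sub_add_cancel (by omega), hi₀] at heq
      exact absurd (hother k₀ (by omega)) (by change ¬ frozen n u (i + 1 + 1) k₀ < n; omega)
    · have := frozen_add_two_of_freezesAt hf
      have := hlt k
      change frozen n u (i + 2) k = n
      omega

end Frozen

/-! ### Measurability with respect to sub-families of the samples -/

section Measurability

variable {Ω : Type*} {n : ℕ}

/-- The `σ`-algebra generated by the samples with index in `S`. -/
abbrev sampleSigma (U : ℕ → ℕ → Ω → ℝ) (S : Set (ℕ × ℕ)) : MeasurableSpace Ω :=
  ⨆ p ∈ S, MeasurableSpace.comap (U p.1 p.2) inferInstance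

theorem measurable_sampleSigma {U : ℕ → ℕ → Ω → ℝ} {S : Set (ℕ × ℕ)} {j t : ℕ}
    (h : (j, t) ∈ S) : Measurable[sampleSigma U S] (U j t) :=
  (comap_measurable (U j t)).mono
    (le_iSup₂_of_le (f := fun (p : ℕ × ℕ) (_ : p ∈ S) =>
      MeasurableSpace.comap (U p.1 p.2) inferInstance) (j, t) h le_rfl) le_rfl

theorem sampleSigma_mono (U : ℕ → ℕ → Ω → ℝ) {S T : Set (ℕ × ℕ)} (h : S ⊆ T) :
    sampleSigma U S ≤ sampleSigma U T :=
  biSup_mono fun _ hp => h hp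

theorem sampleSigma_le [mΩ : MeasurableSpace Ω] {U : ℕ → ℕ → Ω → ℝ}
    (hU : ∀ j t, Measurable (U j t)) (S : Set (ℕ × ℕ)) : sampleSigma U S ≤ mΩ :=
  iSup₂_le fun p _ => (hU p.1 p.2).comap_le

variable [MeasurableSpace Ω]

theorem measurable_step {g : Ω → ℤ → ℕ} (hg : ∀ k, Measurable fun ω => g ω k) {p c : Ω → ℤ}
    (hp : Measurable p) (hc : Measurable c) {v : Ω → ℝ} (hv : Measurable v) :
    Measurable fun ω => step n (g ω) (p ω) (c ω) (v ω) := by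
  have hgc : Measurable fun ω => (g ω (c ω - 1) : ℝ) := by
    have h1 : Measurable fun x : Ω × ℤ => g x.1 x.2 := measurable_from_prod_countable_left hg
    have h2 : Measurable fun ω => (ω, c ω - 1) := measurable_id.prodMk (hc.sub_const 1)
    exact (Measurable.of_discrete (f := fun m : ℕ => (m : ℝ))).comp (h1.comp h2)
  unfold step
  refine Measurable.ite (measurableSet_eq_fun hc hp) hc ?_
  refine Measurable.ite (measurableSet_lt hv (hgc.div_const _)) hc ?_
  exact Measurable.ite (measurableSet_lt hv
    ((hgc.div_const _).add ((measurable_const.sub hgc).div_const _)))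
    (hc.add_const 1) (hc.sub_const 1)

theorem measurable_path {g : Ω → ℤ → ℕ} (hg : ∀ k, Measurable fun ω => g ω k) (j : ℕ)
    {u : ℕ → Ω → ℝ} (t : ℕ) (hu : ∀ s, s + 1 < t → Measurable (u s)) :
    Measurable fun ω => path n (g ω) j (fun s => u s ω) t := by
  induction t using Nat.strong_induction_on with
  | _ t ih =>
    match t with
    | 0 => exact measurable_const
    | 1 => exact measurable_const
    | t + 2 =>
      exact measurable_step hg (ih t (by omega) fun s hs => hu s (by omega))
        (ih (t + 1) (by omega) fun s hs => hu s (by omega)) (hu t (by omega))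

theorem measurable_frozen {U : ℕ → ℕ → Ω → ℝ} (i : ℕ)
    (hU : ∀ j t, j ≤ i → Measurable (U j t)) (k : ℤ) :
    Measurable fun ω => frozen n (fun j t => U j t ω) i k := by
  classical
  induction i generalizing k with
  | zero => exact measurable_const
  | succ i ih =>
    cases i with
    | zero => exact measurable_const
    | succ i =>
      have hi := fun l => ih (fun j t hj => hU j t (by omega)) l
      refine (hi k).add (Measurable.ite (measurableSet_tendsto _ fun t => ?_)
        measurable_const measurable_const)
      exact measurable_path hi (i + 2) t fun s _ => hU (i + 2) s le_rfl

theorem measurableSet_freezesAt {U : ℕ → ℕ → Ω → ℝ} (i : ℕ)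
    (hU : ∀ j t, j ≤ i + 2 → Measurable (U j t)) (k : ℤ) :
    MeasurableSet {ω | FreezesAt n (fun j t => U j t ω) (i + 2) k} := by
  simp only [freezesAt_add_two]
  refine measurableSet_tendsto _ fun t => ?_
  exact measurable_path (measurable_frozen (i + 1) fun j t hj => hU j t (by omega)) (i + 2) t
    fun s _ => hU (i + 2) s le_rfl

end Measurability

/-! ### Comparison of two neighbouring sites -/

section Balance

variable {Ω : Type*} [mΩ : MeasurableSpace Ω] {μ : Measure Ω} {U : ℕ → ℕ → Ω → ℝ} {n : ℕ}

theorem measure_sample_lt (hU : ∀ j t, Measurable (U j t))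
    (hlaw : ∀ j t, μ.map (U j t) = volume.restrict (Set.Icc 0 1)) (j t : ℕ) {r : ℝ}
    (hr : r ≤ 1) : μ (U j t ⁻¹' Set.Iio r) = ENNReal.ofReal r := by
  rw [← Measure.map_apply (hU j t) measurableSet_Iio, hlaw,
    Measure.restrict_apply measurableSet_Iio]
  have : Set.Iio r ∩ Set.Icc 0 1 = Set.Ico 0 r := by
    ext x
    simp only [Set.mem_inter_iff, Set.mem_Iio, Set.mem_Icc, Set.mem_Ico]
    constructor
    · rintro ⟨h1, h2, -⟩; exact ⟨h2, h1⟩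
    · rintro ⟨h1, h2⟩; exact ⟨h2, h1, by linarith⟩
  rw [this, Real.volume_Ico, sub_zero]

theorem measure_le_sample (hU : ∀ j t, Measurable (U j t))
    (hlaw : ∀ j t, μ.map (U j t) = volume.restrict (Set.Icc 0 1)) (j t : ℕ) {r : ℝ}
    (hr : 0 ≤ r) : μ (U j t ⁻¹' Set.Ici r) = ENNReal.ofReal (1 - r) := by
  rw [← Measure.map_apply (hU j t) measurableSet_Ici, hlaw,
    Measure.restrict_apply measurableSet_Ici]
  have : Set.Ici r ∩ Set.Icc 0 1 = Set.Icc r 1 := by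
    ext x
    simp only [Set.mem_inter_iff, Set.mem_Ici, Set.mem_Icc]
    constructor
    · rintro ⟨h1, -, h2⟩; exact ⟨h1, h2⟩
    · rintro ⟨h1, h2⟩; exact ⟨h1, by linarith, h2⟩
  rw [this, Real.volume_Icc]

theorem ae_sample_mem_Ico (hU : ∀ j t, Measurable (U j t))
    (hlaw : ∀ j t, μ.map (U j t) = volume.restrict (Set.Icc 0 1)) :
    ∀ᵐ ω ∂μ, ∀ j t, 0 ≤ U j t ω ∧ U j t ω < 1 := by
  rw [ae_all_iff]
  intro j
  rw [ae_all_iff]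
  intro t
  have h0 := measure_sample_lt hU hlaw j t (r := 0) zero_le_one
  have h1 := measure_le_sample hU hlaw j t (r := 1) zero_le_one
  rw [ENNReal.ofReal_zero] at h0
  rw [sub_self, ENNReal.ofReal_zero] at h1
  filter_upwards [measure_eq_zero_iff_ae_notMem.1 h0, measure_eq_zero_iff_ae_notMem.1 h1]
    with ω h0 h1
  simpa using And.intro h0 h1

theorem withDensity_inter_preimage (hU : ∀ j t, Measurable (U j t))
    (hind : iIndepFun (fun p : ℕ × ℕ => U p.1 p.2) μ) {S : Set (ℕ × ℕ)} {j t : ℕ}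
    (hjt : (j, t) ∉ S) {h : Ω → ℝ≥0∞} (hh : Measurable[sampleSigma U S] h) {E : Set Ω}
    (hE : MeasurableSet[sampleSigma U S] E) {T : Set ℝ} (hT : MeasurableSet T) :
    μ.withDensity h (E ∩ U j t ⁻¹' T) = μ.withDensity h E * μ (U j t ⁻¹' T) := by
  have hle := sampleSigma_le hU S
  have hindep : Indep (sampleSigma U S) (sampleSigma U {(j, t)}) μ :=
    indep_iSup_of_disjoint
      (m := fun p : ℕ × ℕ => MeasurableSpace.comap (U p.1 p.2) inferInstance)
      (fun p => (hU p.1 p.2).comap_le) hind.iIndep (Set.disjoint_singleton_right.2 hjt)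
  have hT' : MeasurableSet[sampleSigma U {(j, t)}] (U j t ⁻¹' T) :=
    measurable_sampleSigma (Set.mem_singleton _) hT
  have hsets : IndepSets {s | MeasurableSet[sampleSigma U S] s} {U j t ⁻¹' T} μ :=
    indepSets_of_indepSets_of_le_right ((Indep_iff_IndepSets _ _ _).1 hindep)
      (Set.singleton_subset_iff.2 hT')
  have hEm := hle _ hE
  have hTm := hU j t hT
  rw [withDensity_apply _ (hEm.inter hTm), withDensity_apply _ hEm,
    ← lintegral_indicator hEm, ← lintegral_indicator (hEm.inter hTm)]
  have key := lintegral_mul_indicator_eq_lintegral_mul_lintegral_indicator hle 1 hTm hsets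
    (hh.indicator hE)
  rw [lintegral_indicator_const hTm, one_mul] at key
  rw [← key]
  refine lintegral_congr fun ω => ?_
  rw [← Set.inter_indicator_mul]
  simp only [mul_one]

/-- If `m < n` particles are frozen at `k`, the next particle freezes at `k + 1` at least
`2 m / (n - m)` times as likely as at `k`. Indeed every time it is at `k + 1`, it freezes there with
probability `m / n` and steps to `k` with probability `(n - m) / (2 n)`, and it cannot freeze at `k`
without such a step. The statement averages over the past with a weight `h`. -/
theorem freezing_balance (hU : ∀ j t, Measurable (U j t))
    (hind : iIndepFun (fun p : ℕ × ℕ => U p.1 p.2) μ)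
    (hlaw : ∀ j t, μ.map (U j t) = volume.restrict (Set.Icc 0 1))
    (i : ℕ) (k : ℤ) {m : ℕ} (hm : m < n) {h : Ω → ℝ≥0∞}
    (hh : Measurable[sampleSigma U {p | p.1 < i + 2}] h) :
    ENNReal.ofReal (m / (2 * (n - m))) * μ.withDensity h
        {ω | frozen n (fun j t => U j t ω) (i + 1) k = m ∧
          FreezesAt n (fun j t => U j t ω) (i + 2) k} ≤
      ENNReal.ofReal (1 / 4) * μ.withDensity h
        {ω | frozen n (fun j t => U j t ω) (i + 1) k = m ∧
          FreezesAt n (fun j t => U j t ω) (i + 2) (k + 1)} := by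
  set ν := μ.withDensity h with hν
  set X : ℕ → Ω → ℤ := fun t ω => path n (frozen n (fun j t => U j t ω) (i + 1)) (i + 2)
    (fun t => U (i + 2) t ω) t with hX
  -- `E t`: the particle moves to `k + 1` at time `t + 1`
  set E : ℕ → Set Ω := fun t => {ω | frozen n (fun j t => U j t ω) (i + 1) k = m ∧
    X t ω ≠ X (t + 1) ω ∧ X (t + 1) ω = k + 1} with hE
  have hmn : (m : ℝ) < n := by exact_mod_cast hm
  have hm0 : (0 : ℝ) ≤ m := m.cast_nonneg
  have hn0 : (0 : ℝ) < n := by linarith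
  set r : ℝ := m / n with hr
  set r' : ℝ := m / n + (n - m) / (2 * n) with hr'
  have hr1 : r ≤ 1 := (div_le_one hn0).2 hmn.le
  have hr0 : 0 ≤ r' :=
    add_nonneg (div_nonneg hm0 hn0.le) (div_nonneg (by linarith) (by linarith))
  have hEmeas : ∀ t, MeasurableSet[sampleSigma U {p | p.1 < i + 2 ∨ (p.1 = i + 2 ∧ p.2 < t)}]
      (E t) := by
    intro t
    let _ := sampleSigma U {p | p.1 < i + 2 ∨ (p.1 = i + 2 ∧ p.2 < t)}
    have hfr : ∀ l, Measurable fun ω => frozen n (fun j t => U j t ω) (i + 1) l :=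
      measurable_frozen (i + 1) fun j s hj =>
        measurable_sampleSigma (Or.inl (show j < i + 2 by omega))
    have hXm : ∀ s, s ≤ t + 1 → Measurable (X s) := fun s hs =>
      measurable_path hfr (i + 2) s fun q hq =>
        measurable_sampleSigma (Or.inr ⟨rfl, show q < t by omega⟩)
    exact ((hfr k) (measurableSet_singleton m)).inter
      ((measurableSet_eq_fun (hXm t (by omega)) (hXm (t + 1) le_rfl)).compl.inter
        ((hXm (t + 1) le_rfl) (measurableSet_singleton (k + 1))))
  have hh' : ∀ t, Measurable[sampleSigma U {p | p.1 < i + 2 ∨ (p.1 = i + 2 ∧ p.2 < t)}] h :=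
    fun t => hh.mono (sampleSigma_mono U fun p hp => Or.inl hp) le_rfl
  have hnot : ∀ t, (i + 2, t) ∉ {p : ℕ × ℕ | p.1 < i + 2 ∨ (p.1 = i + 2 ∧ p.2 < t)} := by
    intro t; simp
  have hup : ∀ t, ν (E t ∩ U (i + 2) t ⁻¹' Set.Iio r) = ν (E t) * ENNReal.ofReal r := fun t => by
    rw [hν, withDensity_inter_preimage hU hind (hnot t) (hh' t) (hEmeas t) measurableSet_Iio,
      measure_sample_lt hU hlaw _ _ hr1]
  have hdown : ∀ t, ν (E t ∩ U (i + 2) t ⁻¹' Set.Ici r') = ν (E t) * ENNReal.ofReal (1 - r') :=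
    fun t => by
      rw [hν, withDensity_inter_preimage hU hind (hnot t) (hh' t) (hEmeas t) measurableSet_Ici,
        measure_le_sample hU hlaw _ _ hr0]
  have hleft : ν {ω | frozen n (fun j t => U j t ω) (i + 1) k = m ∧
      FreezesAt n (fun j t => U j t ω) (i + 2) k} ≤ ∑' t, ν (E t) * ENNReal.ofReal (1 - r') := by
    simp only [← hdown]
    refine le_trans (measure_mono_ae ?_) (measure_iUnion_le _)
    filter_upwards [(withDensity_absolutelyContinuous μ h).ae_le (ae_sample_mem_Ico hU hlaw)]
      with ω hω hfr
    obtain ⟨hfm, hf⟩ := hfr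
    have hki := (hf.mem_Ico fun j t => (hω j t).1).2
    obtain ⟨t, h1, h2, h3⟩ := exists_stepDown_of_tendsto (by push_cast; omega)
      (freezesAt_add_two.1 hf)
    rw [hfm] at h3
    exact Set.mem_iUnion.2 ⟨t, ⟨hfm, h1, h2⟩, h3⟩
  have hright : ∑' t, ν (E t) * ENNReal.ofReal r ≤
      ν {ω | frozen n (fun j t => U j t ω) (i + 1) k = m ∧
        FreezesAt n (fun j t => U j t ω) (i + 2) (k + 1)} := by
    simp only [← hup]
    rw [← measure_iUnion]
    · refine measure_mono (Set.iUnion_subset fun t ω hω => ⟨hω.1.1, ?_⟩)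
      refine freezesAt_add_two.2 (tendsto_path_of_freeze hω.1.2.2 ?_)
      have := hω.2
      rw [add_sub_cancel_right, hω.1.1]
      exact this
    · -- after freezing there are no further genuine moves
      have hlt : ∀ s t, s < t → Disjoint (E s ∩ U (i + 2) s ⁻¹' Set.Iio r)
          (E t ∩ U (i + 2) t ⁻¹' Set.Iio r) := by
        intro s t hst
        rw [Set.disjoint_left]
        rintro ω ⟨⟨hfm, hne, hk⟩, hs⟩ ⟨⟨-, hne', -⟩, -⟩
        have h2 : X (s + 2) ω = X (s + 1) ω := by
          simp only [hX] at hk ⊢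
          rw [path_add_two, step]
          split_ifs with h3 h4
          · rfl
          · rfl
          all_goals
            refine absurd ?_ h4
            rw [hk, add_sub_cancel_right, hfm]
            exact hs
        exact hne' ((path_eq_of_path_succ_eq h2 (show s + 1 ≤ t by omega)).trans
          (path_eq_of_path_succ_eq h2 (show s + 1 ≤ t + 1 by omega)).symm)
      intro s t hst
      rcases lt_or_gt_of_ne hst with h | h
      · exact hlt s t h
      · exact (hlt t s h).symm
    · exact fun t => (sampleSigma_le hU _ _ (hEmeas t)).inter (hU _ _ measurableSet_Iio)
  calc _ ≤ ENNReal.ofReal (m / (2 * (n - m))) * ∑' t, ν (E t) * ENNReal.ofReal (1 - r') := by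
        gcongr
    _ = ENNReal.ofReal (1 / 4) * ∑' t, ν (E t) * ENNReal.ofReal r := by
        rw [ENNReal.tsum_mul_right, ENNReal.tsum_mul_right, mul_left_comm, mul_left_comm
          (ENNReal.ofReal (1 / 4)), ← ENNReal.ofReal_mul, ← ENNReal.ofReal_mul (by norm_num)]
        · congr 2
          have : (n : ℝ) - m ≠ 0 := by linarith
          rw [hr, hr']
          field_simp
          ring
        · exact div_nonneg hm0 (by linarith)
    _ ≤ _ := by gcongr

end Balance

/-! ### The potential of a pair of neighbouring sites -/

/-- The factor by which the potential grows when the site already holding `m` particles receives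
another one. -/
noncomputable def gain (n m : ℕ) : ℝ := 1 + m / (2 * (n - m))

open Classical in
/-- The potential of the sites `k`, `k + 1` once `i + 1` particles are placed: each particle frozen
at `k` multiplies it by a gain, each particle frozen at `k + 1` by `3 / 4`, until `k` holds `n`
particles, from when on the potential is constant. -/
noncomputable def potential (n : ℕ) (u : ℕ → ℕ → ℝ) (k : ℤ) : ℕ → ℝ≥0∞
  | 0 => 1
  | i + 1 => potential n u k i *
      if frozen n u (i + 1) k < n then
        if FreezesAt n u (i + 2) k then ENNReal.ofReal (gain n (frozen n u (i + 1) k))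
        else if FreezesAt n u (i + 2) (k + 1) then ENNReal.ofReal (3 / 4) else 1
      else 1

theorem le_potential {n : ℕ} {u : ℕ → ℕ → ℝ} {k : ℤ} (hk : 1 ≤ k) (i : ℕ) :
    (∏ m ∈ Finset.range (min (frozen n u (i + 1) k) n), ENNReal.ofReal (gain n m)) *
      ENNReal.ofReal (3 / 4) ^ frozen n u (i + 1) (k + 1) ≤ potential n u k i := by
  induction i with
  | zero =>
    rw [zero_add, frozen_one_of_pos (by omega), frozen_one_of_pos (by omega)]
    simp [potential]
  | succ i ih =>
    have h34 : ENNReal.ofReal (3 / 4) ≤ 1 := ENNReal.ofReal_le_one.2 (by norm_num)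
    rw [potential]
    change (∏ m ∈ Finset.range (min (frozen n u (i + 2) k) n), ENNReal.ofReal (gain n m)) *
      ENNReal.ofReal (3 / 4) ^ frozen n u (i + 2) (k + 1) ≤ _
    split_ifs with hlt h1 h2
    · have h3 : ¬ FreezesAt n u (i + 2) (k + 1) := fun h => by
        have := h.unique h1
        omega
      rw [min_eq_left hlt.le] at ih
      rw [frozen_add_two_of_freezesAt h1, frozen_add_two_of_not_freezesAt h3, min_eq_left hlt,
        Finset.prod_range_succ, mul_right_comm]
      gcongr
    · rw [frozen_add_two_of_freezesAt h2, frozen_add_two_of_not_freezesAt h1, pow_succ,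
        ← mul_assoc]
      gcongr
    · rw [frozen_add_two_of_not_freezesAt h2, frozen_add_two_of_not_freezesAt h1, mul_one]
      exact ih
    · have hmono : frozen n u (i + 1) k ≤ frozen n u (i + 2) k := frozen_mono k (by omega)
      have hmono' : frozen n u (i + 1) (k + 1) ≤ frozen n u (i + 2) (k + 1) :=
        frozen_mono (k + 1) (by omega)
      rw [mul_one]
      refine le_trans ?_ ih
      rw [min_eq_right (by omega), min_eq_right (by omega)]
      exact mul_le_mul_right (pow_le_pow_right_of_le_one' h34 hmono') _

theorem prod_gain (n : ℕ) :
    ∏ m ∈ Finset.range n, gain n m = (n.centralBinom : ℝ) / 2 ^ n := by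
  have h1 : ∀ m ∈ Finset.range n, gain n m = ((2 * n - m : ℕ) : ℝ) / (2 * ((n - m : ℕ) : ℝ)) := by
    intro m hm
    have hm := Finset.mem_range.1 hm
    have hmn : (m : ℝ) < n := by exact_mod_cast hm
    have : (n : ℝ) - m ≠ 0 := by linarith
    rw [Nat.cast_sub (by omega), Nat.cast_sub hm.le, gain]
    push_cast
    field_simp
    ring
  rw [Finset.prod_congr rfl h1, Finset.prod_div_distrib, Finset.prod_mul_distrib,
    Finset.prod_const, Finset.card_range, ← Nat.cast_prod, ← Nat.cast_prod,
    ← Nat.descFactorial_eq_prod_range, ← Nat.descFactorial_eq_prod_range, Nat.descFactorial_self,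
    Nat.descFactorial_eq_factorial_mul_choose, Nat.centralBinom]
  have : (n.factorial : ℝ) ≠ 0 := by exact_mod_cast n.factorial_ne_zero
  push_cast
  field_simp

theorem pow_le_prod_gain {n : ℕ} (hn : 1 ≤ n) :
    (9 / 8 : ℝ) ^ (n - 1) ≤ (∏ m ∈ Finset.range n, gain n m) * (3 / 4) ^ (n - 1) := by
  rw [prod_gain]
  induction n, hn using Nat.le_induction with
  | base => simp [Nat.centralBinom]
  | succ n hn ih =>
    have h1 : ((n : ℝ) + 1) * (n + 1).centralBinom = 2 * (2 * n + 1) * n.centralBinom := by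
      exact_mod_cast Nat.succ_mul_centralBinom_succ n
    have hn' : (1 : ℝ) ≤ n := by exact_mod_cast hn
    have h2 : 3 * (n.centralBinom : ℝ) ≤ (n + 1).centralBinom := by
      have hc : (0 : ℝ) ≤ n.centralBinom := Nat.cast_nonneg _
      refine le_of_mul_le_mul_left (a := (n : ℝ) + 1) ?_ (by linarith)
      rw [h1]
      nlinarith
    obtain ⟨q, rfl⟩ := Nat.exists_eq_add_of_le' hn
    simp only [Nat.add_sub_cancel] at ih ⊢
    calc (9 / 8 : ℝ) ^ (q + 1) = 9 / 8 * (9 / 8) ^ q := pow_succ' _ _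
      _ ≤ 9 / 8 * ((q + 1).centralBinom / 2 ^ (q + 1) * (3 / 4) ^ q) := by gcongr
      _ = 3 * (q + 1).centralBinom / 2 ^ (q + 1 + 1) * (3 / 4) ^ (q + 1) := by ring
      _ ≤ _ := by gcongr

section Blockage

variable {Ω : Type*} [mΩ : MeasurableSpace Ω] {μ : Measure Ω} {U : ℕ → ℕ → Ω → ℝ} {n : ℕ}

theorem measurable_potential (k : ℤ) (i : ℕ) (hU : ∀ j t, j ≤ i + 1 → Measurable (U j t)) :
    Measurable fun ω => potential n (fun j t => U j t ω) k i := by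
  classical
  induction i with
  | zero => exact measurable_const
  | succ i ih =>
    have hf := measurable_frozen (n := n) (U := U) (i + 1) (fun j t hj => hU j t (by omega)) k
    have hs := measurableSet_freezesAt (n := n) (U := U) i (fun j t hj => hU j t (by omega))
    refine (ih fun j t hj => hU j t (by omega)).mul (Measurable.ite
      (hf (measurableSet_Iio (a := n))) (Measurable.ite (hs k) ?_
        (Measurable.ite (hs (k + 1)) measurable_const measurable_const)) measurable_const)
    exact (Measurable.of_discrete (f := fun m : ℕ => ENNReal.ofReal (gain n m))).comp hf

/-- The mean potential does not exceed its initial value: it is a supermartingale, as the gains are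
chosen so that `freezing_balance` makes up for them. -/
theorem lintegral_potential_le [IsProbabilityMeasure μ] (hU : ∀ j t, Measurable (U j t))
    (hind : iIndepFun (fun p : ℕ × ℕ => U p.1 p.2) μ)
    (hlaw : ∀ j t, μ.map (U j t) = volume.restrict (Set.Icc 0 1)) (k : ℤ) (i : ℕ) :
    ∫⁻ ω, potential n (fun j t => U j t ω) k i ∂μ ≤ 1 := by
  classical
  induction i with
  | zero => simp [potential]
  | succ i ih =>
    refine le_trans ?_ ih
    set D : Ω → ℝ≥0∞ := fun ω => potential n (fun j t => U j t ω) k i with hD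
    set A : ℤ → ℕ → Set Ω := fun l m => {ω | frozen n (fun j t => U j t ω) (i + 1) k = m ∧
      FreezesAt n (fun j t => U j t ω) (i + 2) l} with hA
    have hDm : Measurable D := measurable_potential k i fun j t _ => hU j t
    have hDpast : Measurable[sampleSigma U {p | p.1 < i + 2}] D :=
      @measurable_potential Ω (sampleSigma U {p | p.1 < i + 2}) U n k i fun j t hj =>
        measurable_sampleSigma (show j < i + 2 by omega)
    have hAm : ∀ l m, MeasurableSet (A l m) := fun l m =>
      (measurable_frozen (i + 1) (fun j t _ => hU j t) k (measurableSet_singleton m)).inter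
        (measurableSet_freezesAt i (fun j t _ => hU j t) l)
    have hpt : ∀ ω, potential n (fun j t => U j t ω) k (i + 1) +
        ∑ m ∈ Finset.range n, ENNReal.ofReal (1 / 4) * (A (k + 1) m).indicator D ω =
        D ω + ∑ m ∈ Finset.range n, ENNReal.ofReal (m / (2 * (n - m))) *
          (A k m).indicator D ω := by
      intro ω
      have hsum : ∀ (c : ℕ → ℝ≥0∞) (l : ℤ),
          ∑ m ∈ Finset.range n, c m * (A l m).indicator D ω =
            if frozen n (fun j t => U j t ω) (i + 1) k < n then
              (if FreezesAt n (fun j t => U j t ω) (i + 2) l then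
                c (frozen n (fun j t => U j t ω) (i + 1) k) * D ω else 0) else 0 := by
        intro c l
        simp only [hA, Set.indicator, Set.mem_ofPred_eq, ite_and, mul_ite, mul_zero,
          Finset.sum_ite_eq, Finset.mem_range]
      rw [hsum, hsum, potential]
      change D ω * _ + _ = _
      by_cases hlt : frozen n (fun j t => U j t ω) (i + 1) k < n
      · simp only [if_pos hlt]
        by_cases h1 : FreezesAt n (fun j t => U j t ω) (i + 2) k
        · have h2 : ¬ FreezesAt n (fun j t => U j t ω) (i + 2) (k + 1) := fun h => by
            have := h.unique h1
            omega
          have hlt' : (frozen n (fun j t => U j t ω) (i + 1) k : ℝ) < n := by exact_mod_cast hlt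
          rw [if_pos h1, if_neg h2, if_pos h1, add_zero, gain,
            ENNReal.ofReal_add zero_le_one (div_nonneg (Nat.cast_nonneg _) (by linarith)),
            ENNReal.ofReal_one]
          ring
        · by_cases h2 : FreezesAt n (fun j t => U j t ω) (i + 2) (k + 1)
          · rw [if_neg h1, if_pos h2, if_pos h2, if_neg h1, add_zero, mul_comm, ← add_mul,
              ← ENNReal.ofReal_add (by norm_num) (by norm_num)]
            norm_num
          · simp [h1, h2]
      · simp [hlt]
    have hint := lintegral_congr (μ := μ) hpt
    rw [lintegral_add_right _ (Finset.measurable_fun_sum _ fun m _ =>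
        (hDm.indicator (hAm _ m)).const_mul _),
      lintegral_add_right _ (Finset.measurable_fun_sum _ fun m _ =>
        (hDm.indicator (hAm _ m)).const_mul _),
      lintegral_finsetSum _ fun m _ => (hDm.indicator (hAm _ m)).const_mul _,
      lintegral_finsetSum _ fun m _ => (hDm.indicator (hAm _ m)).const_mul _] at hint
    simp only [lintegral_const_mul _ (hDm.indicator (hAm _ _)), lintegral_indicator (hAm _ _),
      ← withDensity_apply D (hAm _ _)] at hint
    have hbal : ∑ m ∈ Finset.range n, ENNReal.ofReal (m / (2 * (n - m))) *
          μ.withDensity D (A k m) ≤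
        ∑ m ∈ Finset.range n, ENNReal.ofReal (1 / 4) * μ.withDensity D (A (k + 1) m) :=
      Finset.sum_le_sum fun m hm =>
        freezing_balance hU hind hlaw i k (Finset.mem_range.1 hm) hDpast
    have hfin : ∑ m ∈ Finset.range n, ENNReal.ofReal (1 / 4) *
        μ.withDensity D (A (k + 1) m) ≠ ∞ := by
      refine (ENNReal.sum_lt_top.2 fun m _ => ENNReal.mul_lt_top ENNReal.ofReal_lt_top ?_).ne
      rw [withDensity_apply D (hAm _ _)]
      exact (setLIntegral_le_lintegral _ _).trans_lt (ih.trans_lt ENNReal.one_lt_top)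
    refine ENNReal.le_of_add_le_add_right hfin ?_
    rw [hint]
    gcongr

/-- The probability that the site `k` fills up before its right neighbour does. -/
theorem measure_full_before_right_le [IsProbabilityMeasure μ] (hn : 1 ≤ n)
    (hU : ∀ j t, Measurable (U j t))
    (hind : iIndepFun (fun p : ℕ × ℕ => U p.1 p.2) μ)
    (hlaw : ∀ j t, μ.map (U j t) = volume.restrict (Set.Icc 0 1)) {k : ℤ} (hk : 1 ≤ k) :
    μ {ω | ∃ i, frozen n (fun j t => U j t ω) (i + 1) k = n ∧
        frozen n (fun j t => U j t ω) (i + 1) (k + 1) < n} ≤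
      ENNReal.ofReal ((8 / 9) ^ (n - 1)) := by
  set C : ℝ≥0∞ := ENNReal.ofReal ((9 / 8) ^ (n - 1)) with hC
  set full : ℕ → Set Ω := fun i => {ω | frozen n (fun j t => U j t ω) (i + 1) k = n ∧
    frozen n (fun j t => U j t ω) (i + 1) (k + 1) < n} with hfull
  -- on `full i` the potential is at least `C`, at time `i` and forever after
  have hge : ∀ i, full i ⊆ {ω | C ≤ potential n (fun j t => U j t ω) k i} := by
    rintro i ω ⟨h1, h2⟩
    refine le_trans ?_ (le_potential hk i)
    rw [h1, min_self]
    have h34 : ENNReal.ofReal (3 / 4) ≤ 1 := ENNReal.ofReal_le_one.2 (by norm_num)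
    refine le_trans ?_ (mul_le_mul_right
      (pow_le_pow_right_of_le_one' h34 (show _ ≤ n - 1 by omega)) _)
    have hnn : ∀ m ∈ Finset.range n, 0 ≤ gain n m := fun m hm => by
      have : (m : ℝ) < n := by exact_mod_cast Finset.mem_range.1 hm
      exact add_nonneg zero_le_one (div_nonneg m.cast_nonneg (by linarith))
    rw [← ENNReal.ofReal_prod_of_nonneg hnn, ← ENNReal.ofReal_pow (by norm_num),
      ← ENNReal.ofReal_mul (Finset.prod_nonneg hnn)]
    exact ENNReal.ofReal_le_ofReal (pow_le_prod_gain hn)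
  have hstep : ∀ i ω, n ≤ frozen n (fun j t => U j t ω) (i + 1) k →
      potential n (fun j t => U j t ω) k (i + 1) = potential n (fun j t => U j t ω) k i := by
    intro i ω h
    rw [potential, if_neg (not_lt.2 h), mul_one]
  have hge' : ∀ i N, i ≤ N → full i ⊆ {ω | C ≤ potential n (fun j t => U j t ω) k N} := by
    intro i N hN ω hω
    have : potential n (fun j t => U j t ω) k N = potential n (fun j t => U j t ω) k i := by
      induction N, hN using Nat.le_induction with
      | base => rfl
      | succ N hN ih => rw [hstep N ω (hω.1.ge.trans (frozen_mono k (by omega))), ih]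
    exact (hge i hω).trans this.ge
  have hacc : {ω | ∃ i, frozen n (fun j t => U j t ω) (i + 1) k = n ∧
      frozen n (fun j t => U j t ω) (i + 1) (k + 1) < n} = ⋃ N, Set.accumulate full N := by
    rw [Set.iUnion_accumulate]
    ext ω
    simp [hfull]
  have hCpos : (0 : ℝ) < (9 / 8) ^ (n - 1) := by positivity
  have hinv : ENNReal.ofReal ((8 / 9) ^ (n - 1)) = 1 / C := by
    rw [hC, one_div, ← ENNReal.ofReal_inv_of_pos hCpos, ← inv_pow]
    norm_num
  rw [hacc, Set.monotone_accumulate.measure_iUnion, hinv]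
  refine iSup_le fun N => ?_
  rw [ENNReal.le_div_iff_mul_le (Or.inl (ENNReal.ofReal_pos.2 hCpos).ne')
    (Or.inl ENNReal.ofReal_ne_top), mul_comm]
  refine le_trans ?_ (lintegral_potential_le (n := n) hU hind hlaw k N)
  refine le_trans ?_ (mul_meas_ge_le_lintegral
    (measurable_potential k N fun j t _ => hU j t) C)
  gcongr
  exact Set.iUnion₂_subset fun i hi => hge' i N hi

end Blockage

theorem exp_mul_pow_lt {n : ℕ} (hn : 2 ≤ n) :
    Real.exp (1 / 50 * n) * (8 / 9) ^ (n - 1) < Real.exp (-(1 / 50 * n)) := by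
  have h1 : Real.exp (2 / 25) < 9 / 8 := by
    have h := Real.one_sub_le_exp_neg (2 / 25)
    rw [Real.exp_neg] at h
    have hpos := Real.exp_pos (2 / 25)
    have h2 : (1 - 2 / 25) * Real.exp (2 / 25) ≤ 1 := by
      calc _ ≤ (Real.exp (2 / 25))⁻¹ * Real.exp (2 / 25) := by gcongr
        _ = 1 := inv_mul_cancel₀ hpos.ne'
    linarith
  have hn' : (2 : ℝ) ≤ n := by exact_mod_cast hn
  have h2 : Real.exp (1 / 25 * n) < (9 / 8) ^ (n - 1) := by
    calc Real.exp (1 / 25 * n) ≤ Real.exp (((n - 1 : ℕ) : ℝ) * (2 / 25)) := by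
          rw [Real.exp_le_exp, Nat.cast_sub (by omega)]
          push_cast
          linarith
      _ = Real.exp (2 / 25) ^ (n - 1) := Real.exp_nat_mul _ _
      _ < _ := pow_lt_pow_left₀ h1 (Real.exp_pos _).le (by omega)
  have h3 : (8 / 9 : ℝ) ^ (n - 1) * (9 / 8) ^ (n - 1) = 1 := by
    rw [← mul_pow]; norm_num
  have h4 : (0 : ℝ) < (8 / 9) ^ (n - 1) := by positivity
  calc Real.exp (1 / 50 * n) * (8 / 9) ^ (n - 1)
      = Real.exp (-(1 / 50 * n)) * ((8 / 9) ^ (n - 1) * Real.exp (1 / 25 * n)) := by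
        rw [mul_left_comm, ← Real.exp_add, mul_comm]
        congr 2
        ring
    _ < Real.exp (-(1 / 50 * n)) * ((8 / 9) ^ (n - 1) * (9 / 8) ^ (n - 1)) := by gcongr
    _ = _ := by rw [h3, mul_one]

end Clogging

open Clogging in
theorem theorem2p1 :
    ∃ c : ℝ, 0 < c ∧ ∀ n : ℕ, 2 ≤ n →
      ∀ (Ω : Type*) [MeasurableSpace Ω] (μ : Measure Ω) [IsProbabilityMeasure μ]
        (U : ℕ → ℕ → Ω → ℝ),
        (∀ j t, Measurable (U j t)) →
        iIndepFun (fun p : ℕ × ℕ => U p.1 p.2) μ →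
        (∀ j t, μ.map (U j t) = volume.restrict (Set.Icc 0 1)) →
        μ {ω | Clogging.leftmostBlockage n (fun j t => U j t ω) <
            ((Real.exp (c * n) : ℝ) : EReal)} <
          ENNReal.ofReal (Real.exp (-(c * n))) := by
  refine ⟨1 / 50, by norm_num, fun n hn Ω _ μ _ U hU hind hlaw => ?_⟩
  set K : ℕ := ⌊Real.exp (1 / 50 * n)⌋₊ with hK
  calc _ ≤ μ (⋃ k ∈ Finset.Icc 1 K, {ω | ∃ i,
          frozen n (fun j t => U j t ω) (i + 1) (k : ℕ) = n ∧
            frozen n (fun j t => U j t ω) (i + 1) ((k : ℕ) + 1) < n}) := by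
        refine measure_mono_ae ?_
        filter_upwards [ae_sample_mem_Ico hU hlaw] with ω hω hB
        have hB : leftmostBlockage n (fun j t => U j t ω) < _ := hB
        simp only [leftmostBlockage, iInf_lt_iff, EReal.coe_lt_coe_iff, exists_prop] at hB
        obtain ⟨k₀, hk₀, hlt⟩ := hB
        obtain ⟨k, hk1, hkk₀, hi⟩ := hk₀.exists_first hn (fun j t => (hω j t).1)
          fun j t => (hω j t).2
        lift k to ℕ using by omega
        have hkK : k ≤ K := by
          refine Nat.le_floor (le_trans ?_ hlt.le)
          exact_mod_cast hkk₀
        exact Set.mem_biUnion (Finset.mem_coe.2 (Finset.mem_Icc.2 ⟨by omega, hkK⟩)) hi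
    _ ≤ ∑ k ∈ Finset.Icc 1 K, ENNReal.ofReal ((8 / 9) ^ (n - 1)) := by
        refine (measure_biUnion_finset_le _ _).trans (Finset.sum_le_sum fun k hk => ?_)
        have := (Finset.mem_Icc.1 hk).1
        exact measure_full_before_right_le (by omega) hU hind hlaw (by omega)
    _ = ENNReal.ofReal (K * (8 / 9) ^ (n - 1)) := by
        rw [Finset.sum_const, Nat.card_Icc, Nat.add_sub_cancel, nsmul_eq_mul,
          ENNReal.ofReal_mul K.cast_nonneg, ENNReal.ofReal_natCast]
    _ < _ := by
        refine (ENNReal.ofReal_lt_ofReal_iff (Real.exp_pos _)).2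
          (lt_of_le_of_lt ?_ (exp_mul_pow_lt hn))
        gcongr
        exact Nat.floor_le (Real.exp_pos _).le
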